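/- Let $\mathbb{S}^2\subset\mathbb{R}^3$ be the unit sphere with its standard round metric $g_0$, and let $B_1\subset\mathbb{R}^2$ be the open unit disc. Let $H^1(\mathbb{S}^2,g_0)$ be the completion of $C^\infty(\mathbb{S}^2)$ in the norm $\left(\|u\|_{L^2}^2+\|\nabla_{g_0}u\|_{L^2}^2\right)^{1/2}$, and let $H^1_0(B_1)$ be the closure of $C^\infty_c(B_1)$ in the norm $\left(\|u\|_{L^2(B_1)}^2+\|\nabla u\|_{L^2(B_1)}^2\right)^{1/2}$. Assume that Onofri's inequality holds on $(\mathbb{S}^2,g_0)$: for every $u\in H^1(\mathbb{S}^2,g_0)$, the function $e^u$ is integrable on $\mathbb{S}^2$ and $$\ln\left(\frac{1}{4\pi}\int_{\mathbb{S}^2}e^u\,dv_{g_0}\right)\le\frac{1}{16\pi}\int_{\mathbb{S}^2}|\nabla_{g_0}u|_{g_0}^2\,dv_{g_0}+\frac{1}{4\pi}\int_{\mathbb{S}^2}u\,dv_{g_0}.$$ Then for every $u\in H^1_0(B_1)$ the function $e^u$ is integrable on $B_1$ and $$\ln\left(\frac{1}{\pi}\int_{B_1}e^u\,dx\right)<\frac{1}{16\pi}\int_{B_1}|\nabla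 u|^2\,dx+1.$$ -/

import Mathlib

open MeasureTheory Filter Topology
open scoped ContDiff ENNReal

/-- The Euclidean plane `ℝ²`. -/
abbrev Plane : Type := EuclideanSpace ℝ (Fin 2)

/-- Euclidean space `ℝ³`. -/
abbrev Space : Type := EuclideanSpace ℝ (Fin 3)

/-- The unit sphere `𝕊² ⊆ ℝ³`. -/
abbrev UnitSphere : Type := Metric.sphere (0 : Space) 1

/-- The surface measure `dv_{g₀}` of the round sphere (of total mass `4π`). -/
noncomputable def sphereMeasure : Measure UnitSphere :=
  (volume : Measure Space).toSphere

/-- Lebesgue measure on the open unit disc `B₁`. -/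
noncomputable def discMeasure : Measure Plane :=
  volume.restrict (Metric.ball (0 : Plane) 1)

/-- The gradient `∇_{g₀} (Φ|_{𝕊²})` with respect to the round metric `g₀` (the metric induced from
`ℝ³`) of the restriction to `𝕊²` of a smooth function `Φ` on `ℝ³`: the orthogonal projection of the
Euclidean gradient of `Φ` to the tangent plane `x^⊥` of the sphere at `x`. It depends only on the
values of `Φ` on the sphere. -/
noncomputable def sphereGradient (Φ : Space → ℝ) (x : UnitSphere) : Space :=
  gradient Φ (x : Space) - inner ℝ (x : Space) (gradient Φ (x : Space)) • (x : Space)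

/-- `HasSphereH1Gradient u G` says that `u` belongs to the Sobolev space `H¹(𝕊², g₀)`, with gradient
`G = ∇_{g₀} u`. The space is the completion of `C^∞(𝕊²)` in the `H¹` norm: `u` and `G` are `L²` limits
of `fₙ` and `∇_{g₀} fₙ` for one sequence of smooth functions `fₙ` on the sphere. (The smooth functions
on the sphere are the restrictions of the smooth functions on `ℝ³`, and `u` determines `G` almost
everywhere.) -/
structure HasSphereH1Gradient (u : UnitSphere → ℝ) (G : UnitSphere → Space) : Prop where
  memLp : MemLp u 2 sphereMeasure
  memLp_gradient : MemLp G 2 sphereMeasure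
  approx : ∃ Φ : ℕ → Space → ℝ, (∀ n, ContDiff ℝ ∞ (Φ n)) ∧
    Tendsto (fun n => eLpNorm (fun x : UnitSphere => Φ n (x : Space) - u x) 2 sphereMeasure)
      atTop (𝓝 0) ∧
    Tendsto (fun n => eLpNorm (fun x : UnitSphere => sphereGradient (Φ n) x - G x) 2 sphereMeasure)
      atTop (𝓝 0)

/-- `HasDiscH10Gradient u G` says that (the restriction to `B₁` of) `u` belongs to the Sobolev space
`H¹₀(B₁)`, with weak gradient `G = ∇u`. The space is the closure of `C_c^∞(B₁)` in the `H¹` norm: `u`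
and `G` are the `L²(B₁)` limits of `φₙ` and `∇φₙ` for one sequence of test functions `φₙ`.
(`u` determines `G` almost everywhere in `B₁`.) -/
structure HasDiscH10Gradient (u : Plane → ℝ) (G : Plane → Plane) : Prop where
  memLp : MemLp u 2 discMeasure
  memLp_gradient : MemLp G 2 discMeasure
  approx : ∃ φ : ℕ → Plane → ℝ,
    (∀ n, ContDiff ℝ ∞ (φ n) ∧ HasCompactSupport (φ n) ∧
      tsupport (φ n) ⊆ Metric.ball (0 : Plane) 1) ∧
    Tendsto (fun n => eLpNorm (fun x => φ n x - u x) 2 discMeasure) atTop (𝓝 0) ∧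
    Tendsto (fun n => eLpNorm (fun x => gradient (φ n) x - G x) 2 discMeasure) atTop (𝓝 0)

/-- Onofri's inequality on `H¹(𝕊², g₀)`. That the left-hand side is finite, which is part of the
inequality, is the first conjunct. -/
def OnofriInequality : Prop :=
  ∀ (u : UnitSphere → ℝ) (G : UnitSphere → Space), HasSphereH1Gradient u G →
    Integrable (fun x => Real.exp (u x)) sphereMeasure ∧
    Real.log (1 / (4 * Real.pi) * ∫ x, Real.exp (u x) ∂sphereMeasure) ≤
      1 / (16 * Real.pi) * ∫ x, ‖G x‖ ^ 2 ∂sphereMeasure +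
        1 / (4 * Real.pi) * ∫ x, u x ∂sphereMeasure

open scoped Pointwise

/-! Stereographic projection turns Onofri's inequality into one on the plane with weight
`roundDensity`, that is ρ = 4/(1+|x|²)², for functions constant near infinity
(`OnofriInequality.plane`); the Dirichlet integral is conformally invariant.

For a test function φ supported in |x|² ≤ a, apply it to f = φ + g, where g = 2 log(1+|x|²) on that
disc and is flattened to a constant further out. On the disc e^g ρ = 4, so the weight disappears
from the exponential integral. Since Δ(2 log(1+|x|²)) = 2ρ, the cross term of the energy is -4∫φρ,
which cancels the linear term of Onofri's inequality exactly. The explicit radial integrals of g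
leave, with E = (1/16π)∫|∇φ|², (1/π)∫(e^φ - 1) + 1 + 2a ≤ (2 + a) e^(E+1)
(`OnofriInequality.exp_test_le`).

Now dilate φ from the unit disc to radius l and take a = l². The energy is unchanged and ∫(e^φ - 1)
scales by l², so dividing by l² and letting l → ∞ gives (1/π)∫_{B₁} e^φ + 1 ≤ e^(E+1)
(`OnofriInequality.exp_test_disc_le`). Fatou's lemma carries this to H¹₀. The extra 1 on the left
survives the limit and makes the final inequality strict. -/

lemma plane_norm_sq (x : Plane) : ‖x‖ ^ 2 = x 0 ^ 2 + x 1 ^ 2 := by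
  rw [EuclideanSpace.norm_sq_eq, Fin.sum_univ_two]; simp

lemma space_norm_sq (y : Space) : ‖y‖ ^ 2 = y 0 ^ 2 + y 1 ^ 2 + y 2 ^ 2 := by
  rw [EuclideanSpace.norm_sq_eq, Fin.sum_univ_three]; simp

/-! ### Stereographic projection and the surface measure in its coordinates. -/

/-- The inverse stereographic projection from the north pole, as a map into `ℝ³`. -/
noncomputable def stereoVec (x : Plane) : Space :=
  !₂[2 * x 0 / (1 + (x 0 ^ 2 + x 1 ^ 2)), 2 * x 1 / (1 + (x 0 ^ 2 + x 1 ^ 2)),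
    (x 0 ^ 2 + x 1 ^ 2 - 1) / (1 + (x 0 ^ 2 + x 1 ^ 2))]

lemma norm_stereoVec (x : Plane) : ‖stereoVec x‖ = 1 := by
  have h : ‖stereoVec x‖ ^ 2 = 1 := by
    have : 1 + (x 0 ^ 2 + x 1 ^ 2) ≠ 0 := by positivity
    rw [space_norm_sq]
    simp [stereoVec]
    field_simp
    ring
  have := norm_nonneg (stereoVec x)
  nlinarith

/-- The inverse stereographic projection from the north pole. -/
noncomputable def stereoInv (x : Plane) : UnitSphere :=
  ⟨stereoVec x, by simp [norm_stereoVec]⟩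

/-- The conformal factor of the inverse stereographic projection. -/
noncomputable def roundDensity (x : Plane) : ℝ := 4 / (1 + ‖x‖ ^ 2) ^ 2

lemma contDiff_stereoVec : ContDiff ℝ ∞ stereoVec := by
  rw [contDiff_euclidean]
  have h : ∀ i : Fin 2, ContDiff ℝ ∞ (fun x : Plane => x i) := fun i => contDiff_piLp_apply 2
  have h0 := h 0
  have h1 := h 1
  have hne : ∀ x : Plane, 1 + (x 0 ^ 2 + x 1 ^ 2) ≠ 0 := fun x => by positivity
  intro i
  fin_cases i
  · exact ContDiff.div (by fun_prop) (by fun_prop) hne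
  · exact ContDiff.div (by fun_prop) (by fun_prop) hne
  · exact ContDiff.div (by fun_prop) (by fun_prop) hne

lemma continuous_stereoInv : Continuous stereoInv :=
  contDiff_stereoVec.continuous.subtype_mk _

lemma continuous_roundDensity : Continuous roundDensity := by
  unfold roundDensity
  exact continuous_const.div (by fun_prop) (fun x => by positivity)

lemma roundDensity_pos (x : Plane) : 0 < roundDensity x := by
  unfold roundDensity; positivity

/-- Polynomial coordinates on `ℝ³` adapted to cones over subsets of the sphere. -/
noncomputable def coneMap (v : Fin 3 → ℝ) : Fin 3 → ℝ :=
  ![v 2 * v 0, v 2 * v 1, v 2 * (v 0 ^ 2 + v 1 ^ 2 - 1) / 2]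

/-- The Jacobian matrix of `coneMap`. -/
noncomputable def coneMatrix (v : Fin 3 → ℝ) : Matrix (Fin 3) (Fin 3) ℝ :=
  !![v 2, 0, v 0; 0, v 2, v 1; v 2 * v 0, v 2 * v 1, (v 0 ^ 2 + v 1 ^ 2 - 1) / 2]

lemma hasFDerivAt_coneMap (v : Fin 3 → ℝ) :
    HasFDerivAt coneMap (LinearMap.toContinuousLinearMap (Matrix.toLin' (coneMatrix v))) v := by
  have h : ∀ i : Fin 3, HasFDerivAt (fun v : Fin 3 → ℝ => v i)
    (ContinuousLinearMap.proj (R := ℝ) (φ := fun _ : Fin 3 => ℝ) i) v := fun i => hasFDerivAt_apply i v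
  rw [hasFDerivAt_pi']
  intro i
  fin_cases i
  · refine ((h 2).mul (h 0)).congr_fderiv ?_
    ext w
    simp [coneMatrix, dotProduct, Fin.sum_univ_three]
    try ring
  · refine ((h 2).mul (h 1)).congr_fderiv ?_
    ext w
    simp [coneMatrix, dotProduct, Fin.sum_univ_three]
    try ring
  · have := ((h 2).mul ((((h 0).pow 2).add ((h 1).pow 2)).sub_const 1)).mul_const (1/2 : ℝ)
    refine (this.congr_of_eventuallyEq ?_).congr_fderiv ?_
    · refine Eventually.of_forall fun w => ?_
      simp [coneMap]; ring
    · ext w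
      simp [coneMatrix, dotProduct, Fin.sum_univ_three]
      ring

lemma det_coneMatrix (v : Fin 3 → ℝ) :
    (LinearMap.toContinuousLinearMap (Matrix.toLin' (coneMatrix v))).det =
      -(v 2 ^ 2 * (1 + (v 0 ^ 2 + v 1 ^ 2)) / 2) := by
  simp only [ContinuousLinearMap.det, LinearMap.coe_toContinuousLinearMap, LinearMap.det_toLin']
  simp [coneMatrix, Matrix.det_fin_three]
  ring

lemma injOn_coneMap : Set.InjOn coneMap {v | 0 < v 2} := by
  intro v hv w hw h
  simp only [Set.mem_ofPred_eq] at hv hw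
  have h0 : v 2 * v 0 = w 2 * w 0 := congrFun h 0
  have h1 : v 2 * v 1 = w 2 * w 1 := congrFun h 1
  have h2 : v 2 * (v 0 ^ 2 + v 1 ^ 2 - 1) / 2 = w 2 * (w 0 ^ 2 + w 1 ^ 2 - 1) / 2 := congrFun h 2
  -- With y the common image and s² = y₀² + y₁², both v₂ and w₂ are positive roots t of t² + 2y₂t -
  -- s² = 0. The product of the roots is -s² ≤ 0, so there is only one positive root.
  have key : (v 2 - w 2) * ((v 2 * v 0) ^ 2 + (v 2 * v 1) ^ 2 + v 2 * w 2) = 0 := by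
    have e : (v 2 * v 0) ^ 2 + (v 2 * v 1) ^ 2 = (w 2 * w 0) ^ 2 + (w 2 * w 1) ^ 2 := by
      rw [h0, h1]
    linear_combination (-2 * v 2 * w 2) * h2 + (v 2) * e
  have h22 : v 2 = w 2 := by
    rcases mul_eq_zero.1 key with h | h
    · linarith
    · have := mul_pos hv hw
      nlinarith [sq_nonneg (v 2 * v 0), sq_nonneg (v 2 * v 1)]
  funext i
  fin_cases i
  · rw [h22] at h0; exact mul_left_cancel₀ hw.ne' h0
  · rw [h22] at h1; exact mul_left_cancel₀ hw.ne' h1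
  · exact h22

lemma lintegral_fin_three (F : (Fin 3 → ℝ) → ℝ≥0∞) (hF : Measurable F) :
    ∫⁻ v, F v = ∫⁻ x : Plane, ∫⁻ t : ℝ, F ![x 0, x 1, t] := by
  have h := (volume_preserving_piFinSuccAbove (fun _ : Fin 3 => ℝ) 2).symm
  have hm : Measurable fun p : ℝ × (Fin 2 → ℝ) => F ![p.2 0, p.2 1, p.1] :=
    hF.comp (measurable_pi_iff.2 fun i => by fin_cases i <;> simp <;> fun_prop)
  have e : ∀ p : ℝ × (Fin 2 → ℝ),
      (MeasurableEquiv.piFinSuccAbove (fun _ : Fin 3 => ℝ) 2).symm p = ![p.2 0, p.2 1, p.1] := by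
    intro p
    funext i
    fin_cases i <;> rfl
  rw [← h.lintegral_comp hF]
  simp only [e]
  rw [Measure.volume_eq_prod, lintegral_prod_symm' _ hm,
    ← (PiLp.volume_preserving_ofLp (Fin 2)).lintegral_comp hm.lintegral_prod_left']

/-- The stereographic projection from the north pole. -/
noncomputable def stereoProj (y : Space) : Plane := !₂[y 0 / (1 - y 2), y 1 / (1 - y 2)]

lemma stereoProj_stereoVec (x : Plane) : stereoProj (stereoVec x) = x := by
  have : 1 + (x 0 ^ 2 + x 1 ^ 2) ≠ 0 := by positivity
  have h : 1 - (x 0 ^ 2 + x 1 ^ 2 - 1) / (1 + (x 0 ^ 2 + x 1 ^ 2)) =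
      2 / (1 + (x 0 ^ 2 + x 1 ^ 2)) := by field_simp; ring
  ext i
  fin_cases i
  · simp [stereoProj, stereoVec, h]; field_simp
  · simp [stereoProj, stereoVec, h]; field_simp

lemma stereoVec_stereoProj {y : Space} (hy : ‖y‖ = 1) (h2 : y 2 ≠ 1) :
    stereoVec (stereoProj y) = y := by
  have hn : y 0 ^ 2 + y 1 ^ 2 + y 2 ^ 2 = 1 := by rw [← space_norm_sq, hy]; norm_num
  have h1 : 1 - y 2 ≠ 0 := sub_ne_zero.2 h2.symm
  have hq : (y 0 / (1 - y 2)) ^ 2 + (y 1 / (1 - y 2)) ^ 2 = (1 + y 2) / (1 - y 2) := by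
    field_simp
    linear_combination hn
  have hq' : 1 + (1 + y 2) / (1 - y 2) = 2 / (1 - y 2) := by field_simp; ring
  ext i
  fin_cases i
  · simp [stereoProj, stereoVec, hq, hq']; field_simp
  · simp [stereoProj, stereoVec, hq, hq']; field_simp
  · simp [stereoProj, stereoVec, hq, hq']; field_simp; ring

/-- The third coordinate is the radius rescaled by 2/(1+|x|²), which clears the denominators of
`stereoVec` and makes `coneMap` polynomial. Radius below 1 becomes the upper bound in `coneDomain`.
-/
lemma toLp_coneMap (v : Fin 3 → ℝ) :
    WithLp.toLp 2 (coneMap v) =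
      (v 2 * (1 + (v 0 ^ 2 + v 1 ^ 2)) / 2) • stereoVec !₂[v 0, v 1] := by
  have : 1 + (v 0 ^ 2 + v 1 ^ 2) ≠ 0 := by positivity
  ext i
  fin_cases i
  · simp [coneMap, stereoVec]; field_simp
  · simp [coneMap, stereoVec]; field_simp
  · simp [coneMap, stereoVec]; field_simp

/-- The set of cone coordinates of the points of the open unit ball over a subset of the sphere. -/
def coneDomain (s : Set UnitSphere) : Set (Fin 3 → ℝ) :=
  {v | 0 < v 2 ∧ v 2 < 2 / (1 + (v 0 ^ 2 + v 1 ^ 2)) ∧ stereoInv !₂[v 0, v 1] ∈ s}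

lemma measurableSet_coneDomain {s : Set UnitSphere} (hs : MeasurableSet s) :
    MeasurableSet (coneDomain s) := by
  have h2 : Measurable fun v : Fin 3 → ℝ => 2 / (1 + (v 0 ^ 2 + v 1 ^ 2)) := by fun_prop
  have h3 : Measurable fun v : Fin 3 → ℝ => stereoInv !₂[v 0, v 1] := by
    refine continuous_stereoInv.measurable.comp ?_
    exact (WithLp.measurable_toLp 2 (Fin 2 → ℝ)).comp
      (measurable_pi_iff.2 fun i => by fin_cases i <;> simp <;> fun_prop)
  exact (measurableSet_lt measurable_const (measurable_pi_apply 2)).inter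
    ((measurableSet_lt (measurable_pi_apply 2) h2).inter (h3 hs))

lemma volume_cone_eq {s : Set UnitSphere} :
    (volume : Measure Space) (Set.Ioo (0 : ℝ) 1 • ((↑) '' s : Set Space)) =
      volume (coneMap '' coneDomain s) := by
  have hp := (EuclideanSpace.volume_preserving_symm_measurableEquiv_toLp (Fin 3)).symm
  have e : (volume : Measure Space) (Set.Ioo (0 : ℝ) 1 • ((↑) '' s : Set Space)) =
      volume ((WithLp.toLp 2 : (Fin 3 → ℝ) → Space) ⁻¹'
        (Set.Ioo (0 : ℝ) 1 • ((↑) '' s : Set Space))) :=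
    (hp.measure_preimage_equiv _).symm
  rw [e]
  -- The projection misses the north pole; the ray through it lies in this null plane.
  have hnull : volume {v : Fin 3 → ℝ | v 0 = 0} = 0 := by
    rw [volume_pi]; exact Measure.pi_hyperplane _ 0 0
  apply le_antisymm
  · calc _ ≤ volume (coneMap '' coneDomain s ∪ {v : Fin 3 → ℝ | v 0 = 0}) := measure_mono ?_
      _ ≤ _ := (measure_union_le _ _).trans (by rw [hnull, add_zero])
    intro v hv
    obtain ⟨r, hr, _, ⟨p, hps, rfl⟩, hv⟩ := Set.mem_smul.1 (Set.mem_preimage.1 hv)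
    have hpn : ‖(p : Space)‖ = 1 := by simp
    have hv' : ∀ i, v i = r * (p : Space) i := fun i => by
      have := congrArg (fun y : Space => y i) hv
      simpa using this.symm
    by_cases hp2 : (p : Space) 2 = 1
    · right
      have hn : (p : Space) 0 ^ 2 + (p : Space) 1 ^ 2 + (p : Space) 2 ^ 2 = 1 := by
        rw [← space_norm_sq, hpn]; norm_num
      have : (p : Space) 0 = 0 := by rw [hp2] at hn; nlinarith [sq_nonneg ((p : Space) 1)]
      simp [hv', this]
    · left
      have hst := stereoVec_stereoProj hpn hp2
      set x := stereoProj (p : Space) with hx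
      have hx2 : (!₂[x 0, x 1] : Plane) = x := by ext i; fin_cases i <;> rfl
      have hq : 0 < 1 + (x 0 ^ 2 + x 1 ^ 2) := by positivity
      refine ⟨![x 0, x 1, 2 * r / (1 + (x 0 ^ 2 + x 1 ^ 2))], ⟨?_, ?_, ?_⟩, ?_⟩
      · simp only [Matrix.cons_val]
        have := hr.1
        positivity
      · simp only [Matrix.cons_val, Matrix.cons_val_zero, Matrix.cons_val_one]
        gcongr
        linarith [hr.2]
      · simp only [Matrix.cons_val_zero, Matrix.cons_val_one]
        rw [hx2]
        have : stereoInv x = p := Subtype.ext hst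
        rwa [this]
      · apply (WithLp.equiv 2 (Fin 3 → ℝ)).symm.injective
        change WithLp.toLp 2 _ = WithLp.toLp 2 v
        rw [toLp_coneMap, ← hv]
        simp only [Matrix.cons_val, Matrix.cons_val_zero, Matrix.cons_val_one]
        rw [hx2, hst]
        congr 1
        field_simp
  · refine measure_mono ?_
    rintro _ ⟨v, ⟨h0, h1, h2⟩, rfl⟩
    rw [Set.mem_preimage, toLp_coneMap]
    have hq : 0 < 1 + (v 0 ^ 2 + v 1 ^ 2) := by positivity
    rw [lt_div_iff₀ hq] at h1
    exact Set.smul_mem_smul ⟨by positivity, by linarith⟩ ⟨_, h2, rfl⟩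

/-- Change of variables, then integration in t: with q = |x|², the integral of t²(1+q)/2 over 0 < t
< 2/(1+q) is 4/(3(1+q)²). -/
lemma volume_image_coneDomain {s : Set UnitSphere} (hs : MeasurableSet s) :
    3 * volume (coneMap '' coneDomain s) =
      ∫⁻ x in stereoInv ⁻¹' s, ENNReal.ofReal (roundDensity x) := by
  have hD := measurableSet_coneDomain hs
  rw [← lintegral_abs_det_fderiv_eq_addHaar_image volume hD
    (fun v _ => (hasFDerivAt_coneMap v).hasFDerivWithinAt)
    (injOn_coneMap.mono fun v hv => hv.1)]
  have hJ : ∀ v : Fin 3 → ℝ, ENNReal.ofReal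
      |(LinearMap.toContinuousLinearMap (Matrix.toLin' (coneMatrix v))).det| =
      ENNReal.ofReal (v 2 ^ 2 * (1 + (v 0 ^ 2 + v 1 ^ 2)) / 2) := fun v => by
    rw [det_coneMatrix, abs_neg, abs_of_nonneg (by positivity)]
  simp only [hJ]
  rw [← lintegral_indicator hD, lintegral_fin_three _ (Measurable.indicator (by fun_prop) hD),
    ← lintegral_indicator (continuous_stereoInv.measurable hs), ← lintegral_const_mul']
  swap
  · simp
  congr 1
  funext x
  have hx2 : (!₂[x 0, x 1] : Plane) = x := by ext i; fin_cases i <;> rfl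
  have hq : 0 < 1 + (x 0 ^ 2 + x 1 ^ 2) := by positivity
  by_cases hx : stereoInv x ∈ s
  · rw [Set.indicator_of_mem (by exact hx)]
    have e : ∀ t : ℝ, (coneDomain s).indicator (fun v : Fin 3 → ℝ => ENNReal.ofReal
        (v 2 ^ 2 * (1 + (v 0 ^ 2 + v 1 ^ 2)) / 2)) ![x 0, x 1, t] =
        (Set.Ioo 0 (2 / (1 + (x 0 ^ 2 + x 1 ^ 2)))).indicator (fun t => ENNReal.ofReal
          (t ^ 2 * (1 + (x 0 ^ 2 + x 1 ^ 2)) / 2)) t := by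
      intro t
      simp [Set.indicator, coneDomain, hx2, hx]
    simp only [e]
    rw [lintegral_indicator measurableSet_Ioo, Measure.restrict_congr_set Ioo_ae_eq_Ioc,
      ← ofReal_integral_eq_lintegral_ofReal]
    · rw [← intervalIntegral.integral_of_le (by positivity), roundDensity, plane_norm_sq]
      have : (3 : ℝ≥0∞) = ENNReal.ofReal 3 := by simp
      rw [this, ← ENNReal.ofReal_mul (by norm_num)]
      congr 1
      simp
      field_simp
      ring
    · exact (Continuous.intervalIntegrable (by fun_prop) _ _).1
    · exact Eventually.of_forall fun t => by positivity
  · rw [Set.indicator_of_notMem (by exact hx)]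
    have e : ∀ t : ℝ, (coneDomain s).indicator (fun v : Fin 3 → ℝ => ENNReal.ofReal
        (v 2 ^ 2 * (1 + (v 0 ^ 2 + v 1 ^ 2)) / 2)) ![x 0, x 1, t] = 0 := by
      intro t
      simp [Set.indicator, coneDomain, hx2, hx]
    simp [e]

/-- `Measure.toSphere` is the dimension, 3, times the volume of the cone over the set. -/
theorem sphereMeasure_eq_map : sphereMeasure =
    (volume.withDensity fun x => ENNReal.ofReal (roundDensity x)).map stereoInv := by
  ext s hs
  rw [sphereMeasure, Measure.toSphere_apply' _ hs, Measure.map_apply continuous_stereoInv.measurable hs,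
    withDensity_apply _ (continuous_stereoInv.measurable hs), volume_cone_eq,
    ← volume_image_coneDomain hs]
  simp

theorem integral_sphereMeasure {F : UnitSphere → ℝ} (hF : Continuous F) :
    ∫ p, F p ∂sphereMeasure = ∫ x, F (stereoInv x) * roundDensity x := by
  rw [sphereMeasure_eq_map, integral_map continuous_stereoInv.aemeasurable hF.aestronglyMeasurable,
    integral_withDensity_eq_integral_toReal_smul (by
      exact continuous_roundDensity.measurable.ennreal_ofReal) (by simp)]
  congr 1
  funext x
  rw [ENNReal.toReal_ofReal (roundDensity_pos x).le, smul_eq_mul, mul_comm]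

theorem integrable_sphereMeasure {F : UnitSphere → ℝ} (hF : Continuous F) :
    Integrable (fun x => F (stereoInv x) * roundDensity x) := by
  have : IsFiniteMeasure sphereMeasure := by unfold sphereMeasure; infer_instance
  have h : Integrable F sphereMeasure := by
    obtain ⟨C, hC⟩ := isCompact_univ.exists_bound_of_continuousOn hF.continuousOn
    exact Integrable.of_bound hF.aestronglyMeasurable C (Eventually.of_forall fun x => hC x trivial)
  rw [sphereMeasure_eq_map, integrable_map_measure hF.aestronglyMeasurable
    continuous_stereoInv.aemeasurable, integrable_withDensity_iff (by
      exact continuous_roundDensity.measurable.ennreal_ofReal) (by simp)] at h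
  refine h.congr (Eventually.of_forall fun x => ?_)
  simp only [Function.comp]
  rw [ENNReal.toReal_ofReal (roundDensity_pos x).le]

/-! ### Conformal invariance of the Dirichlet integral, and Onofri's inequality on the plane. -/

lemma gradient_apply_eq_fderiv (f : Plane → ℝ) (x : Plane) (i : Fin 2) :
    gradient f x i = fderiv ℝ f x (EuclideanSpace.single i 1) := by
  rw [← inner_gradient_left, EuclideanSpace.inner_single_right]
  simp

lemma norm_gradient_sq (f : Plane → ℝ) (x : Plane) :
    ‖gradient f x‖ ^ 2 = fderiv ℝ f x (EuclideanSpace.single 0 1) ^ 2 +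
      fderiv ℝ f x (EuclideanSpace.single 1 1) ^ 2 := by
  rw [plane_norm_sq, gradient_apply_eq_fderiv, gradient_apply_eq_fderiv]

lemma space_inner (v w : Space) : inner ℝ v w = v 0 * w 0 + v 1 * w 1 + v 2 * w 2 := by
  rw [PiLp.inner_apply, Fin.sum_univ_three]
  simp [mul_comm]

lemma hasDerivAt_space_curve {γ : ℝ → Space} {γ' : Space} {t : ℝ}
    (h : ∀ i, HasDerivAt (fun t => γ t i) (γ' i) t) : HasDerivAt γ γ' t := by
  have h1 : HasDerivAt (fun t => (fun i => γ t i : Fin 3 → ℝ)) (fun i => γ' i) t :=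
    hasDerivAt_pi.2 h
  exact (PiLp.hasFDerivAt_toLp (𝕜 := ℝ) 2 (fun i => γ t i : Fin 3 → ℝ)).comp_hasDerivAt t h1

lemma hasDerivAt_stereoVec_zero (x : Plane) :
    HasDerivAt (fun t : ℝ => stereoVec (x + t • EuclideanSpace.single 0 1))
      !₂[2 * (1 - x 0 ^ 2 + x 1 ^ 2) / (1 + (x 0 ^ 2 + x 1 ^ 2)) ^ 2,
        -4 * x 0 * x 1 / (1 + (x 0 ^ 2 + x 1 ^ 2)) ^ 2,
        4 * x 0 / (1 + (x 0 ^ 2 + x 1 ^ 2)) ^ 2] 0 := by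
  have hne : 1 + (x 0 ^ 2 + x 1 ^ 2) ≠ 0 := by positivity
  have hne' : 1 + ((x 0 + 0) ^ 2 + x 1 ^ 2) ≠ 0 := by simpa using hne
  have hl : HasDerivAt (fun t : ℝ => x 0 + t) 1 0 := (hasDerivAt_id _).const_add _
  have hq : HasDerivAt (fun t : ℝ => (x 0 + t) ^ 2 + x 1 ^ 2) (2 * x 0) 0 := by
    simpa using (hl.pow 2).add_const (x 1 ^ 2)
  have hD := hq.const_add 1
  refine hasDerivAt_space_curve fun i => ?_
  fin_cases i
  · have := (hl.const_mul 2).div hD hne'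
    refine (this.congr_of_eventuallyEq (Eventually.of_forall fun t => ?_)).congr_deriv ?_
    · simp [stereoVec]
    · simp; field_simp; ring
  · have := (hasDerivAt_const (0 : ℝ) (2 * x 1)).div hD hne'
    refine (this.congr_of_eventuallyEq (Eventually.of_forall fun t => ?_)).congr_deriv ?_
    · simp [stereoVec]
    · simp; field_simp; ring
  · have := (hq.sub_const 1).div hD hne'
    refine (this.congr_of_eventuallyEq (Eventually.of_forall fun t => ?_)).congr_deriv ?_
    · simp [stereoVec]
    · simp; field_simp; ring

lemma hasDerivAt_stereoVec_one (x : Plane) :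
    HasDerivAt (fun t : ℝ => stereoVec (x + t • EuclideanSpace.single 1 1))
      !₂[-4 * x 0 * x 1 / (1 + (x 0 ^ 2 + x 1 ^ 2)) ^ 2,
        2 * (1 + x 0 ^ 2 - x 1 ^ 2) / (1 + (x 0 ^ 2 + x 1 ^ 2)) ^ 2,
        4 * x 1 / (1 + (x 0 ^ 2 + x 1 ^ 2)) ^ 2] 0 := by
  have hne : 1 + (x 0 ^ 2 + x 1 ^ 2) ≠ 0 := by positivity
  have hne' : 1 + (x 0 ^ 2 + (x 1 + 0) ^ 2) ≠ 0 := by simpa using hne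
  have hl : HasDerivAt (fun t : ℝ => x 1 + t) 1 0 := (hasDerivAt_id _).const_add _
  have hq : HasDerivAt (fun t : ℝ => x 0 ^ 2 + (x 1 + t) ^ 2) (2 * x 1) 0 := by
    simpa using (hl.pow 2).const_add (x 0 ^ 2)
  have hD := hq.const_add 1
  refine hasDerivAt_space_curve fun i => ?_
  fin_cases i
  · have := (hasDerivAt_const (0 : ℝ) (2 * x 0)).div hD hne'
    refine (this.congr_of_eventuallyEq (Eventually.of_forall fun t => ?_)).congr_deriv ?_
    · simp [stereoVec]
    · simp; field_simp; ring
  · have := (hl.const_mul 2).div hD hne'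
    refine (this.congr_of_eventuallyEq (Eventually.of_forall fun t => ?_)).congr_deriv ?_
    · simp [stereoVec]
    · simp; field_simp; ring
  · have := (hq.sub_const 1).div hD hne'
    refine (this.congr_of_eventuallyEq (Eventually.of_forall fun t => ?_)).congr_deriv ?_
    · simp [stereoVec]
    · simp; field_simp; ring

/-- The inverse stereographic projection is conformal with factor `roundDensity`. -/
lemma norm_gradient_comp_stereoVec_sq {Φ : Space → ℝ} (hΦ : Differentiable ℝ Φ) (x : Plane) :
    ‖sphereGradient Φ (stereoInv x)‖ ^ 2 * roundDensity x =
      ‖gradient (fun x => Φ (stereoVec x)) x‖ ^ 2 := by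
  have hd : DifferentiableAt ℝ (fun x => Φ (stereoVec x)) x :=
    (hΦ _).comp x (contDiff_stereoVec.differentiable (by simp) x)
  have key : ∀ (i : Fin 2) (w : Space),
      HasDerivAt (fun t : ℝ => stereoVec (x + t • EuclideanSpace.single i 1)) w 0 →
      fderiv ℝ (fun x => Φ (stereoVec x)) x (EuclideanSpace.single i 1) =
        inner ℝ (gradient Φ (stereoVec x)) w := by
    intro i w hw
    have h1 : HasDerivAt (fun t : ℝ => Φ (stereoVec (x + t • EuclideanSpace.single i 1)))
        (fderiv ℝ Φ (stereoVec x) w) 0 := by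
      have hx : stereoVec x = stereoVec (x + (0 : ℝ) • EuclideanSpace.single i 1) := by simp
      rw [hx]
      exact (hΦ _).hasFDerivAt.comp_hasDerivAt (0 : ℝ) hw
    rw [inner_gradient_left]
    exact (hd.hasFDerivAt.hasLineDerivAt (EuclideanSpace.single i 1)).unique h1
  rw [norm_gradient_sq, key 0 _ (hasDerivAt_stereoVec_zero x), key 1 _ (hasDerivAt_stereoVec_one x)]
  simp only [sphereGradient, stereoInv]
  generalize gradient Φ (stereoVec x) = v
  -- Pythagoras: the tangential part loses the square of the normal component.
  have hn : ‖v - inner ℝ (stereoVec x) v • stereoVec x‖ ^ 2 =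
      ‖v‖ ^ 2 - inner ℝ (stereoVec x) v ^ 2 := by
    rw [norm_sub_sq_real, norm_smul, norm_stereoVec, inner_smul_right, real_inner_comm]
    simp
    ring
  have hne : 1 + (x 0 ^ 2 + x 1 ^ 2) ≠ 0 := by positivity
  rw [hn, roundDensity, plane_norm_sq, space_norm_sq, space_inner, space_inner, space_inner]
  simp [stereoVec]
  field_simp
  ring

lemma continuous_sphereGradient {Φ : Space → ℝ} (hΦ : ContDiff ℝ ∞ Φ) :
    Continuous (sphereGradient Φ) := by
  have h1 : Continuous (gradient Φ) :=
    (InnerProductSpace.toDual ℝ Space).symm.continuous.comp (hΦ.continuous_fderiv (by simp))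
  have h2 : Continuous fun x : UnitSphere => gradient Φ (x : Space) :=
    h1.comp continuous_subtype_val
  have h3 : Continuous fun x : UnitSphere => inner ℝ (x : Space) (gradient Φ (x : Space)) • (x : Space) := by
    fun_prop
  exact h2.sub h3

instance : IsFiniteMeasure sphereMeasure := by unfold sphereMeasure; infer_instance

lemma memLp_sphereMeasure {E : Type*} [NormedAddCommGroup E] [SecondCountableTopology E]
    {F : UnitSphere → E} (hF : Continuous F) (p : ℝ≥0∞) :
    MemLp F p sphereMeasure := by
  obtain ⟨C, hC⟩ := isCompact_univ.exists_bound_of_continuousOn hF.continuousOn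
  exact MemLp.of_bound hF.aestronglyMeasurable C (Eventually.of_forall fun x => hC x trivial)

lemma hasSphereH1Gradient_of_contDiff {Φ : Space → ℝ} (hΦ : ContDiff ℝ ∞ Φ) :
    HasSphereH1Gradient (fun x => Φ x) (sphereGradient Φ) where
  memLp := memLp_sphereMeasure (hΦ.continuous.comp continuous_subtype_val) 2
  memLp_gradient := memLp_sphereMeasure (continuous_sphereGradient hΦ) 2
  approx := ⟨fun _ => Φ, fun _ => hΦ, by simp, by simp⟩

/-- A smooth function on the plane that is constant near infinity is the pullback under the inverse
stereographic projection of a smooth function. -/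
lemma exists_contDiff_comp_stereoVec {f : Plane → ℝ} (hf : ContDiff ℝ ∞ f) {c R : ℝ} (hR : 0 ≤ R)
    (hc : ∀ x, R ≤ ‖x‖ ^ 2 → f x = c) :
    ∃ Φ : Space → ℝ, ContDiff ℝ ∞ Φ ∧ ∀ x, Φ (stereoVec x) = f x := by
  have hR' : 0 < R + 1 := by linarith
  set A : ℝ := (R + 1) with hA
  -- As 1 - y₂ = 2/(1+|x|²) on the sphere, χ is 1 where |x|² ≤ R, and it vanishes for y₂ ≥ 1 - 1/A,
  -- hence near the pole, where `stereoProj` is singular.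
  set χ : ℝ → ℝ := fun z => Real.smoothTransition (A * (1 - z) - 1) with hχ
  have hχs : ContDiff ℝ ∞ χ := Real.smoothTransition.contDiff.comp (by fun_prop)
  have hcoord : ∀ i : Fin 3, ContDiff ℝ ∞ (fun y : Space => y i) := fun i => contDiff_piLp_apply 2
  refine ⟨fun y => c + χ (y 2) * (f (stereoProj y) - c), ?_, ?_⟩
  · refine contDiff_const.add (contDiff_iff_contDiffAt.2 fun y => ?_)
    by_cases hy : y 2 < 1
    · have h1 : ContDiffAt ℝ ∞ stereoProj y := by
        rw [contDiffAt_euclidean]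
        have hne : 1 - y 2 ≠ 0 := by linarith
        intro i
        fin_cases i
        · exact ((hcoord 0).contDiffAt).div (contDiffAt_const.sub (hcoord 2).contDiffAt) hne
        · exact ((hcoord 1).contDiffAt).div (contDiffAt_const.sub (hcoord 2).contDiffAt) hne
      exact (hχs.comp (hcoord 2)).contDiffAt.mul
        ((hf.contDiffAt.comp y h1).sub contDiffAt_const)
    · refine (contDiffAt_const (c := (0 : ℝ))).congr_of_eventuallyEq ?_
      have hopen : ∀ᶠ z : Space in 𝓝 y, 1 - 1 / A < z 2 := by
        refine (isOpen_lt continuous_const (hcoord 2).continuous).mem_nhds ?_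
        have : 0 < 1 / A := by positivity
        simp only [Set.mem_ofPred_eq]
        linarith
      filter_upwards [hopen] with z hz
      have : A * (1 - z 2) - 1 ≤ 0 := by
        have h : 1 - z 2 < 1 / A := by linarith
        rw [lt_div_iff₀ hR'] at h
        linarith
      simp [hχ, Real.smoothTransition.zero_of_nonpos this]
  · intro x
    simp only [stereoProj_stereoVec]
    by_cases hx : R ≤ ‖x‖ ^ 2
    · simp [hc x hx]
    · have hone : 1 ≤ A * (1 - stereoVec x 2) - 1 := by
        rw [plane_norm_sq, not_le] at hx
        have hq : 0 < 1 + (x 0 ^ 2 + x 1 ^ 2) := by positivity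
        have : 1 - stereoVec x 2 = 2 / (1 + (x 0 ^ 2 + x 1 ^ 2)) := by
          simp [stereoVec]; field_simp; ring
        rw [this, ← mul_div_assoc, le_sub_iff_add_le, le_div_iff₀ hq]
        linarith
      simp [hχ, Real.smoothTransition.one_of_one_le hone]

/-- Onofri's inequality for smooth functions on the plane that are constant near infinity. -/
theorem OnofriInequality.plane (h : OnofriInequality) {f : Plane → ℝ} (hf : ContDiff ℝ ∞ f)
    {c R : ℝ} (hR : 0 ≤ R) (hc : ∀ x, R ≤ ‖x‖ ^ 2 → f x = c) :
    Real.log (1 / (4 * Real.pi) * ∫ x, Real.exp (f x) * roundDensity x) ≤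
      1 / (16 * Real.pi) * (∫ x, ‖gradient f x‖ ^ 2) +
        1 / (4 * Real.pi) * ∫ x, f x * roundDensity x := by
  obtain ⟨Φ, hΦ, hΦf⟩ := exists_contDiff_comp_stereoVec hf hR hc
  have hr : Continuous fun p : UnitSphere => Φ p := hΦ.continuous.comp continuous_subtype_val
  have h1 := (h _ _ (hasSphereH1Gradient_of_contDiff hΦ)).2
  rw [integral_sphereMeasure (F := fun p => Real.exp (Φ p)) (Real.continuous_exp.comp hr),
    integral_sphereMeasure (F := fun p => ‖sphereGradient Φ p‖ ^ 2)
      ((continuous_sphereGradient hΦ).norm.pow 2),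
    integral_sphereMeasure hr] at h1
  simp only [norm_gradient_comp_stereoVec_sq (hΦ.differentiable (by simp))] at h1
  simpa [stereoInv, hΦf] using h1

/-! ### The cutoff of the logarithm and explicit radial integrals. -/

/-- A smooth monotone saturation of the identity: it is `τ` for `τ ≤ A` and constant for
`B ≤ τ`. -/
lemma exists_smooth_saturation {A B : ℝ} (hA : 0 ≤ A) (hAB : A < B) :
    ∃ M : ℝ → ℝ, ContDiff ℝ ∞ M ∧ (∀ τ, τ ≤ A → M τ = τ) ∧ (∀ τ, B ≤ τ → M τ = M B) ∧
      (∀ τ, 0 ≤ deriv M τ ∧ deriv M τ ≤ 1) ∧ (∀ τ, τ ≤ A → deriv M τ = 1) ∧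
      (∀ τ, B ≤ τ → deriv M τ = 0) ∧ (∀ τ, 0 ≤ τ → M τ ≤ min τ B) ∧ (∀ τ, A ≤ τ → A ≤ M τ) := by
  have hBA : 0 < B - A := sub_pos.2 hAB
  set ρ : ℝ → ℝ := fun t => Real.smoothTransition ((B - t) / (B - A)) with hρ
  have hρs : ContDiff ℝ ∞ ρ := Real.smoothTransition.contDiff.comp (by fun_prop)
  set M : ℝ → ℝ := fun τ => ∫ t in (0 : ℝ)..τ, ρ t with hM
  have hd : ∀ τ, HasDerivAt M (ρ τ) τ := fun τ =>
    intervalIntegral.integral_hasDerivAt_right (hρs.continuous.intervalIntegrable _ _)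
      (hρs.continuous.stronglyMeasurableAtFilter _ _) hρs.continuous.continuousAt
  have hderiv : deriv M = ρ := funext fun τ => (hd τ).deriv
  have hdiff : Differentiable ℝ M := fun τ => (hd τ).differentiableAt
  have h1 : ∀ τ, τ ≤ A → ρ τ = 1 := fun τ hτ =>
    Real.smoothTransition.one_of_one_le (by rw [le_div_iff₀ hBA]; linarith)
  have h0 : ∀ τ, B ≤ τ → ρ τ = 0 := fun τ hτ =>
    Real.smoothTransition.zero_of_nonpos (div_nonpos_of_nonpos_of_nonneg (by linarith) hBA.le)
  have hmono : Monotone M := monotone_of_deriv_nonneg hdiff fun τ => by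
    rw [hderiv]; exact Real.smoothTransition.nonneg _
  have hid : ∀ τ, τ ≤ A → M τ = τ := by
    intro τ hτ
    have : ∫ t in (0 : ℝ)..τ, ρ t = ∫ t in (0 : ℝ)..τ, (1 : ℝ) :=
      intervalIntegral.integral_congr fun t ht => h1 t (by
        have := ht.2
        exact this.trans (max_le hA hτ))
    simp [hM, this]
  -- The derivative 1 - ρ is nonnegative; compared with the value 0 at τ = 0 this gives M τ ≤ τ.
  have hanti : Monotone fun τ => τ - M τ := by
    refine monotone_of_deriv_nonneg (differentiable_id.sub hdiff) fun τ => ?_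
    rw [show deriv (fun τ => τ - M τ) τ = 1 - ρ τ from ((hasDerivAt_id τ).sub (hd τ)).deriv]
    exact sub_nonneg.2 (Real.smoothTransition.le_one _)
  have hM0 : M 0 = 0 := by simp [hM]
  have hle : ∀ τ, 0 ≤ τ → M τ ≤ τ := fun τ hτ => by
    have := hanti hτ
    simp only [hM0] at this
    linarith
  have hconst : ∀ τ, B ≤ τ → M τ = M B := by
    intro τ hτ
    have hi : ∀ a b : ℝ, IntervalIntegrable ρ volume a b :=
      fun a b => hρs.continuous.intervalIntegrable _ _
    have e : M τ - M B = ∫ t in B..τ, ρ t :=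
      intervalIntegral.integral_interval_sub_left (hi _ _) (hi _ _)
    have : ∫ t in B..τ, ρ t = ∫ t in B..τ, (0 : ℝ) :=
      intervalIntegral.integral_congr fun t ht => h0 t (by
        rw [Set.uIcc_of_le hτ] at ht; exact ht.1)
    rw [this] at e
    simp at e
    linarith
  refine ⟨M, ?_, hid, hconst, fun τ => ?_, fun τ hτ => by rw [hderiv, h1 τ hτ],
    fun τ hτ => by rw [hderiv, h0 τ hτ], fun τ hτ => le_min (hle τ hτ) ?_, fun τ hτ => ?_⟩
  · exact contDiff_infty_iff_deriv.2 ⟨hdiff, hderiv ▸ hρs⟩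
  · rw [hderiv]
    exact ⟨Real.smoothTransition.nonneg _, Real.smoothTransition.le_one _⟩
  · rcases le_total τ B with h | h
    · exact (hle τ hτ).trans h
    · rw [hconst τ h]; exact hle B (hA.trans hAB.le)
  · calc A = M A := (hid A le_rfl).symm
      _ ≤ M τ := hmono hτ

lemma integrable_roundDensity : Integrable roundDensity := by
  simpa using integrable_sphereMeasure (F := fun _ => 1) continuous_const

lemma integral_radial (F : ℝ → ℝ) :
    ∫ x : Plane, F ‖x‖ = 2 * Real.pi * ∫ r in Set.Ioi (0 : ℝ), r * F r := by
  rw [integral_fun_norm_addHaar volume F]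
  have : (volume : Measure Plane).real (Metric.ball 0 1) = Real.pi := by
    simp [measureReal_def, EuclideanSpace.volume_ball_fin_two, Real.pi_nonneg]
  simp [this, mul_assoc]

lemma integral_Ioi_roundDensity {b : ℝ} (hb : 0 ≤ b) :
    IntegrableOn (fun r : ℝ => r * (4 / (1 + r ^ 2) ^ 2)) (Set.Ioi (Real.sqrt b)) ∧
      ∫ r in Set.Ioi (Real.sqrt b), r * (4 / (1 + r ^ 2) ^ 2) = 2 / (1 + b) := by
  have hd : ∀ r ∈ Set.Ici (Real.sqrt b), HasDerivAt (fun r : ℝ => -(2 / (1 + r ^ 2)))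
      (r * (4 / (1 + r ^ 2) ^ 2)) r := by
    intro r _
    have hne : 1 + r ^ 2 ≠ 0 := by positivity
    have := ((hasDerivAt_const r (2 : ℝ)).div ((hasDerivAt_pow 2 r).const_add 1) hne).neg
    refine this.congr_deriv ?_
    simp
    field_simp
    ring
  have hnn : ∀ r ∈ Set.Ioi (Real.sqrt b), 0 ≤ r * (4 / (1 + r ^ 2) ^ 2) := fun r hr => by
    have : 0 ≤ r := (Real.sqrt_nonneg b).trans (le_of_lt hr)
    positivity
  have ht : Tendsto (fun r : ℝ => -(2 / (1 + r ^ 2))) atTop (𝓝 0) := by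
    rw [← neg_zero]
    refine Tendsto.neg (Tendsto.const_div_atTop ?_ _)
    exact tendsto_atTop_add_const_left _ _ (tendsto_pow_atTop two_ne_zero)
  have hi := integrableOn_Ioi_deriv_of_nonneg' hd hnn ht
  refine ⟨hi, ?_⟩
  rw [integral_Ioi_of_hasDerivAt_of_tendsto' hd hi ht, Real.sq_sqrt hb]
  ring

/-- A radial function that is a multiple of `roundDensity` outside of a disc. -/
lemma integrable_radial_split {k : ℝ → ℝ} (hk : Continuous k) (b C : ℝ) :
    Integrable fun x : Plane => if ‖x‖ ^ 2 ≤ b then k ‖x‖ else C * roundDensity x := by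
  have hcl : IsClosed {x : Plane | ‖x‖ ^ 2 ≤ b} := isClosed_le (by fun_prop) continuous_const
  have hcpt : IsCompact {x : Plane | ‖x‖ ^ 2 ≤ b} := by
    refine Metric.isCompact_of_isClosed_isBounded hcl
      ((Metric.isBounded_closedBall (x := (0 : Plane)) (r := Real.sqrt b)).subset fun x hx => ?_)
    rw [mem_closedBall_zero_iff]
    exact Real.le_sqrt_of_sq_le hx
  have := Integrable.piecewise hcl.measurableSet
    ((hk.comp continuous_norm).continuousOn.integrableOn_compact hcpt)
    ((integrable_roundDensity.const_mul C).integrableOn (s := {x : Plane | ‖x‖ ^ 2 ≤ b}ᶜ))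
  refine this.congr (Eventually.of_forall fun x => ?_)
  simp [Set.piecewise]

lemma integral_radial_split {k : ℝ → ℝ} (hk : Continuous k) {b : ℝ} (hb : 0 ≤ b) (C : ℝ) :
    ∫ x : Plane, (if ‖x‖ ^ 2 ≤ b then k ‖x‖ else C * roundDensity x) =
      2 * Real.pi * (∫ r in (0 : ℝ)..Real.sqrt b, r * k r) + 4 * Real.pi * C / (1 + b) := by
  have h := integral_radial fun r => if r ^ 2 ≤ b then k r else C * (4 / (1 + r ^ 2) ^ 2)
  have e1 : Set.EqOn (fun r : ℝ => r * if r ^ 2 ≤ b then k r else C * (4 / (1 + r ^ 2) ^ 2))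
      (fun r => r * k r) (Set.Ioc 0 (Real.sqrt b)) := fun r hr => by
    have : r ^ 2 ≤ b := (Real.le_sqrt hr.1.le hb).1 hr.2
    simp [this]
  have e2 : Set.EqOn (fun r : ℝ => r * if r ^ 2 ≤ b then k r else C * (4 / (1 + r ^ 2) ^ 2))
      (fun r => C * (r * (4 / (1 + r ^ 2) ^ 2))) (Set.Ioi (Real.sqrt b)) := fun r hr => by
    have : ¬ r ^ 2 ≤ b := not_le.2 ((Real.sqrt_lt' ((Real.sqrt_nonneg b).trans_lt hr)).1 hr)
    simp only [this, if_false]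
    ring
  have i1 : IntegrableOn (fun r : ℝ => r * k r) (Set.Ioc 0 (Real.sqrt b)) :=
    (Continuous.intervalIntegrable (by fun_prop) _ _).1
  have i2 := (integral_Ioi_roundDensity hb).1.const_mul C
  unfold roundDensity
  rw [h, ← Set.Ioc_union_Ioi_eq_Ioi (Real.sqrt_nonneg b),
    setIntegral_union (Set.Ioc_disjoint_Ioi le_rfl) measurableSet_Ioi
      (i1.congr_fun e1.symm measurableSet_Ioc) (IntegrableOn.congr_fun i2 e2.symm measurableSet_Ioi),
    setIntegral_congr_fun measurableSet_Ioc e1, setIntegral_congr_fun measurableSet_Ioi e2,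
    integral_const_mul, (integral_Ioi_roundDensity hb).2,
    intervalIntegral.integral_of_le (Real.sqrt_nonneg b)]
  ring

/-- The integrand is |∇(2 log(1+|x|²))|² on the disc, which bounds the energy of the flattened
logarithm. The else branch is written as a multiple of `roundDensity` to fit
`integral_radial_split`. -/
lemma integral_dirichlet_log {b : ℝ} (hb : 0 ≤ b) :
    ∫ x : Plane, (if ‖x‖ ^ 2 ≤ b then 16 * ‖x‖ ^ 2 / (1 + ‖x‖ ^ 2) ^ 2 else 0 * roundDensity x) =
      16 * Real.pi * (Real.log (1 + b) + 1 / (1 + b) - 1) := by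
  rw [integral_radial_split (k := fun r => 16 * r ^ 2 / (1 + r ^ 2) ^ 2)
    (Continuous.div (by fun_prop) (by fun_prop) fun r => by positivity) hb]
  have hd : ∀ r ∈ Set.uIcc 0 (Real.sqrt b),
      HasDerivAt (fun r : ℝ => 8 * (Real.log (1 + r ^ 2) + 1 / (1 + r ^ 2)))
        (r * (16 * r ^ 2 / (1 + r ^ 2) ^ 2)) r := by
    intro r _
    have hne : 1 + r ^ 2 ≠ 0 := by positivity
    have h := (hasDerivAt_pow 2 r).const_add 1
    have := ((h.log hne).add ((hasDerivAt_const r (1 : ℝ)).div h hne)).const_mul 8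
    refine this.congr_deriv ?_
    simp
    field_simp
    ring
  rw [intervalIntegral.integral_eq_sub_of_hasDerivAt hd (Continuous.intervalIntegrable
    (continuous_id.mul (Continuous.div (by fun_prop) (by fun_prop) fun r => by positivity)) _ _)]
  simp [Real.sq_sqrt hb]
  ring

lemma integral_log_roundDensity {b : ℝ} (hb : 0 ≤ b) :
    ∫ x : Plane, (if ‖x‖ ^ 2 ≤ b then 2 * Real.log (1 + ‖x‖ ^ 2) * (4 / (1 + ‖x‖ ^ 2) ^ 2)
      else 2 * Real.log (1 + b) * roundDensity x) = 8 * Real.pi * (b / (1 + b)) := by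
  have hcl : Continuous fun r : ℝ => Real.log (1 + r ^ 2) :=
    Continuous.log (by fun_prop) fun r => by positivity
  have hcd : Continuous fun r : ℝ => 4 / (1 + r ^ 2) ^ 2 :=
    Continuous.div (by fun_prop) (by fun_prop) fun r => by positivity
  rw [integral_radial_split (k := fun r => 2 * Real.log (1 + r ^ 2) * (4 / (1 + r ^ 2) ^ 2))
    (by fun_prop) hb]
  have hd : ∀ r ∈ Set.uIcc 0 (Real.sqrt b),
      HasDerivAt (fun r : ℝ => -4 * ((Real.log (1 + r ^ 2) + 1) / (1 + r ^ 2)))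
        (r * (2 * Real.log (1 + r ^ 2) * (4 / (1 + r ^ 2) ^ 2))) r := by
    intro r _
    have hne : 1 + r ^ 2 ≠ 0 := by positivity
    have h := (hasDerivAt_pow 2 r).const_add 1
    have := (((h.log hne).add_const 1).div h hne).const_mul (-4)
    refine this.congr_deriv ?_
    simp
    field_simp
    ring
  rw [intervalIntegral.integral_eq_sub_of_hasDerivAt hd (Continuous.intervalIntegrable
    (by fun_prop) _ _)]
  have : 1 + b ≠ 0 := by positivity
  simp [Real.sq_sqrt hb]
  field_simp
  ring

/-- The integrand bounds e^g ρ from below, g being the flattened logarithm: equality inside the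
disc, and g ≥ 2 log(1+a) outside. -/
lemma integral_cap {a : ℝ} (ha : 0 ≤ a) :
    ∫ x : Plane, (if ‖x‖ ^ 2 ≤ a then 4 else (1 + a) ^ 2 * roundDensity x) =
      4 * Real.pi * (1 + 2 * a) := by
  rw [integral_radial_split (k := fun _ => 4) continuous_const ha]
  have : 1 + a ≠ 0 := by positivity
  simp [Real.sq_sqrt ha]
  field_simp
  ring

/-! ### The Liouville equation and integrability. -/

lemma contDiff_plane_coord (i : Fin 2) : ContDiff ℝ ∞ fun x : Plane => x i := contDiff_piLp_apply 2

lemma contDiff_plane_norm_sq : ContDiff ℝ ∞ fun x : Plane => ‖x‖ ^ 2 := contDiff_norm_sq ℝ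

lemma contDiff_log_one_add_norm_sq : ContDiff ℝ ∞ fun x : Plane => Real.log (1 + ‖x‖ ^ 2) :=
  (contDiff_const.add contDiff_plane_norm_sq).log fun x => by positivity

lemma fderiv_log_one_add_norm_sq (x : Plane) (i : Fin 2) :
    fderiv ℝ (fun x : Plane => Real.log (1 + ‖x‖ ^ 2)) x (EuclideanSpace.single i 1) =
      2 * x i / (1 + ‖x‖ ^ 2) := by
  have hne : 1 + ‖x‖ ^ 2 ≠ 0 := by positivity
  have h := (((hasStrictFDerivAt_norm_sq x).hasFDerivAt).const_add 1).log hne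
  rw [h.fderiv]
  simp [EuclideanSpace.inner_single_right]
  field_simp

lemma fderiv_saturated_log {M : ℝ → ℝ} (hM : Differentiable ℝ M) (x : Plane) (i : Fin 2) :
    fderiv ℝ (fun x : Plane => 2 * M (Real.log (1 + ‖x‖ ^ 2))) x (EuclideanSpace.single i 1) =
      deriv M (Real.log (1 + ‖x‖ ^ 2)) * (4 * x i / (1 + ‖x‖ ^ 2)) := by
  have hL := (contDiff_log_one_add_norm_sq.differentiable (by simp) x).hasFDerivAt
  have h := (((hM _).hasDerivAt).comp_hasFDerivAt x hL).const_mul 2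
  have e : fderiv ℝ (fun x : Plane => 2 * M (Real.log (1 + ‖x‖ ^ 2))) x = _ := h.fderiv
  rw [e]
  simp [fderiv_log_one_add_norm_sq]
  ring

lemma contDiff_coord_div (i : Fin 2) : ContDiff ℝ ∞ fun x : Plane => 4 * x i / (1 + ‖x‖ ^ 2) :=
  (contDiff_const.mul (contDiff_plane_coord i)).div
    (contDiff_const.add contDiff_plane_norm_sq) fun x => by positivity

lemma fderiv_coord_div (x : Plane) (i : Fin 2) :
    fderiv ℝ (fun x : Plane => 4 * x i / (1 + ‖x‖ ^ 2)) x (EuclideanSpace.single i 1) =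
      4 / (1 + ‖x‖ ^ 2) - 8 * x i ^ 2 / (1 + ‖x‖ ^ 2) ^ 2 := by
  have hd := ((contDiff_coord_div i).differentiable (by simp) x).hasFDerivAt
  refine (hd.hasLineDerivAt (EuclideanSpace.single i 1)).unique ?_
  have hn : ∀ t : ℝ, ‖x + t • EuclideanSpace.single i (1 : ℝ)‖ ^ 2 =
      ‖x‖ ^ 2 + 2 * x i * t + t ^ 2 := by
    intro t
    rw [norm_add_sq_real, inner_smul_right, EuclideanSpace.inner_single_right, norm_smul]
    simp
    ring
  have hne : 1 + (‖x‖ ^ 2 + 2 * x i * 0 + 0 ^ 2) ≠ 0 := by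
    have : 0 < 1 + ‖x‖ ^ 2 := by positivity
    simpa using this.ne'
  have h1 : HasDerivAt (fun t : ℝ => 4 * (x i + t)) 4 0 := by
    simpa using ((hasDerivAt_id (0 : ℝ)).const_add (x i)).const_mul 4
  have h2 : HasDerivAt (fun t : ℝ => 1 + (‖x‖ ^ 2 + 2 * x i * t + t ^ 2)) (2 * x i) 0 := by
    simpa using ((((hasDerivAt_id (0 : ℝ)).const_mul (2 * x i)).const_add (‖x‖ ^ 2)).add
      (hasDerivAt_pow 2 (0 : ℝ))).const_add 1
  have h3 := h1.div h2 hne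
  unfold HasLineDerivAt
  refine (h3.congr_of_eventuallyEq (Eventually.of_forall fun t => ?_)).congr_deriv ?_
  · simp [hn]
  · have : 1 + ‖x‖ ^ 2 ≠ 0 := by positivity
    simp
    field_simp
    ring

/-- Integration by parts against the i-th component of ∇(2 log(1+|x|²)); the compact support of φ
makes every product integrable. -/
lemma integral_fderiv_mul_coord_div {φ : Plane → ℝ} (hφ : ContDiff ℝ ∞ φ)
    (hc : HasCompactSupport φ) (i : Fin 2) :
    Integrable (fun x => fderiv ℝ φ x (EuclideanSpace.single i 1) * (4 * x i / (1 + ‖x‖ ^ 2))) ∧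
    Integrable (fun x => φ x * (4 / (1 + ‖x‖ ^ 2) - 8 * x i ^ 2 / (1 + ‖x‖ ^ 2) ^ 2)) ∧
    ∫ x, fderiv ℝ φ x (EuclideanSpace.single i 1) * (4 * x i / (1 + ‖x‖ ^ 2)) =
      -∫ x, φ x * (4 / (1 + ‖x‖ ^ 2) - 8 * x i ^ 2 / (1 + ‖x‖ ^ 2) ^ 2) := by
  have hV := contDiff_coord_div i
  have hVd : Continuous fun x : Plane =>
      fderiv ℝ (fun x : Plane => 4 * x i / (1 + ‖x‖ ^ 2)) x (EuclideanSpace.single i 1) :=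
    (hV.continuous_fderiv (by simp)).clm_apply continuous_const
  have hφd : Continuous fun x : Plane => fderiv ℝ φ x (EuclideanSpace.single i 1) :=
    (hφ.continuous_fderiv (by simp)).clm_apply continuous_const
  have i1 : Integrable (fun x => fderiv ℝ φ x (EuclideanSpace.single i 1) *
      (4 * x i / (1 + ‖x‖ ^ 2))) :=
    (hφd.mul hV.continuous).integrable_of_hasCompactSupport
      ((hc.fderiv_apply ℝ (EuclideanSpace.single i 1)).mul_right)
  have i2 : Integrable (fun x => φ x *
      fderiv ℝ (fun x : Plane => 4 * x i / (1 + ‖x‖ ^ 2)) x (EuclideanSpace.single i 1)) :=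
    (hφ.continuous.mul hVd).integrable_of_hasCompactSupport hc.mul_right
  have i3 : Integrable (fun x => φ x * (4 * x i / (1 + ‖x‖ ^ 2))) :=
    (hφ.continuous.mul hV.continuous).integrable_of_hasCompactSupport hc.mul_right
  have h := integral_mul_fderiv_eq_neg_fderiv_mul_of_integrable i1 i2 i3
    (fun x _ => hφ.differentiable (by simp) x) (fun x _ => hV.differentiable (by simp) x)
  simp only [fderiv_coord_div] at h i2
  exact ⟨i1, i2, by rw [h, neg_neg]⟩

/-- The logarithm of the conformal factor solves a Liouville equation. -/
lemma integral_gradient_mul_coord_div {φ : Plane → ℝ} (hφ : ContDiff ℝ ∞ φ)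
    (hc : HasCompactSupport φ) :
    ∫ x, (fderiv ℝ φ x (EuclideanSpace.single 0 1) * (4 * x 0 / (1 + ‖x‖ ^ 2)) +
      fderiv ℝ φ x (EuclideanSpace.single 1 1) * (4 * x 1 / (1 + ‖x‖ ^ 2))) =
      -(2 * ∫ x, φ x * roundDensity x) := by
  obtain ⟨i1, i2, e⟩ := integral_fderiv_mul_coord_div hφ hc 0
  obtain ⟨j1, j2, e'⟩ := integral_fderiv_mul_coord_div hφ hc 1
  rw [integral_add i1 j1, e, e', ← neg_add, ← integral_add i2 j2, ← integral_const_mul]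
  congr 2
  funext x
  have h := plane_norm_sq x
  have : 1 + ‖x‖ ^ 2 ≠ 0 := by positivity
  have h8 : 8 * x 0 ^ 2 / (1 + ‖x‖ ^ 2) ^ 2 = 8 * (‖x‖ ^ 2 - x 1 ^ 2) / (1 + ‖x‖ ^ 2) ^ 2 := by
    rw [h]; ring
  rw [h8, roundDensity]
  field_simp
  ring

lemma hasCompactSupport_of_norm_sq {E : Type*} [Zero E] {F : Plane → E} {R : ℝ}
    (h : ∀ x, R ≤ ‖x‖ ^ 2 → F x = 0) : HasCompactSupport F := by
  refine HasCompactSupport.intro (isCompact_closedBall (0 : Plane) (Real.sqrt R)) fun x hx => ?_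
  rw [mem_closedBall_zero_iff, not_le] at hx
  exact h x ((Real.sqrt_lt' ((Real.sqrt_nonneg R).trans_lt hx)).1 hx).le

lemma integrable_mul_roundDensity {F : Plane → ℝ} (hF : Continuous F) {c R : ℝ}
    (h : ∀ x, R ≤ ‖x‖ ^ 2 → F x = c) : Integrable fun x => F x * roundDensity x := by
  have hs : HasCompactSupport fun x => F x - c :=
    hasCompactSupport_of_norm_sq (R := R) fun x hx => by rw [h x hx, sub_self]
  have h1 : Integrable fun x => (F x - c) * roundDensity x :=
    ((hF.sub continuous_const).mul continuous_roundDensity).integrable_of_hasCompactSupport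
      hs.mul_right
  refine (h1.add (integrable_roundDensity.const_mul c)).congr (Eventually.of_forall fun x => ?_)
  simp only [Pi.add_apply]
  ring

lemma continuous_gradient_plane {φ : Plane → ℝ} (hφ : ContDiff ℝ ∞ φ) : Continuous (gradient φ) :=
  (InnerProductSpace.toDual ℝ Plane).symm.continuous.comp (hφ.continuous_fderiv (by simp))

lemma integrable_norm_gradient_sq {φ : Plane → ℝ} (hφ : ContDiff ℝ ∞ φ) {c R : ℝ}
    (h : ∀ x, R ≤ ‖x‖ ^ 2 → φ x = c) : Integrable fun x => ‖gradient φ x‖ ^ 2 := by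
  refine ((continuous_gradient_plane hφ).norm.pow 2).integrable_of_hasCompactSupport
    -- The gradient vanishes where φ is constant on a neighbourhood, so the radius is enlarged to
    -- make the inequality strict.
    (hasCompactSupport_of_norm_sq (R := R + 1) fun x hx => ?_)
  have : φ =ᶠ[𝓝 x] fun _ => c := by
    have ho : IsOpen {y : Plane | R < ‖y‖ ^ 2} := isOpen_lt continuous_const (by fun_prop)
    filter_upwards [ho.mem_nhds (show R < ‖x‖ ^ 2 by linarith)] with y hy
    exact h y (le_of_lt hy)
  have hg : gradient φ x = 0 := by simp [gradient, this.fderiv_eq]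
  simp [hg]

/-! ### The estimate for test functions. -/

/-- The estimate obtained from Onofri's inequality by adding to a test function the logarithm of the
conformal factor, cut off outside the support. -/
theorem OnofriInequality.exp_test_le (h : OnofriInequality) {φ : Plane → ℝ}
    (hφ : ContDiff ℝ ∞ φ) {a : ℝ} (ha : 0 < a) (hsupp : ∀ x, a ≤ ‖x‖ ^ 2 → φ x = 0) :
    1 / Real.pi * (∫ x, (Real.exp (φ x) - 1)) + 1 + 2 * a ≤
      (2 + a) * Real.exp (1 / (16 * Real.pi) * (∫ x, ‖gradient φ x‖ ^ 2) + 1) := by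
  have hc : HasCompactSupport φ := hasCompactSupport_of_norm_sq hsupp
  -- Any fixed gap would do: replacing 1 + a by 1 + b = 2 + a costs nothing in the limit a → ∞.
  set b := a + 1 with hb
  obtain ⟨M, hM, hMid, hMB, hM01, hM1, hM0, hMle, hMge⟩ :=
    exists_smooth_saturation (A := Real.log (1 + a)) (B := Real.log (1 + b))
      (Real.log_nonneg (by linarith)) (Real.log_lt_log (by linarith) (by linarith))
  set g : Plane → ℝ := fun x => 2 * M (Real.log (1 + ‖x‖ ^ 2)) with hg
  have hgs : ContDiff ℝ ∞ g := contDiff_const.mul (hM.comp contDiff_log_one_add_norm_sq)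
  have hMd : Differentiable ℝ M := hM.differentiable (by simp)
  have hgb : ∀ x : Plane, b ≤ ‖x‖ ^ 2 → g x = 2 * M (Real.log (1 + b)) := fun x hx => by
    simp only [hg]
    rw [hMB _ (Real.log_le_log (by linarith) (by linarith))]
  have hga : ∀ x : Plane, ‖x‖ ^ 2 ≤ a → g x = 2 * Real.log (1 + ‖x‖ ^ 2) := fun x hx => by
    simp only [hg]
    rw [hMid _ (Real.log_le_log (by positivity) (by linarith))]
  set f : Plane → ℝ := fun x => φ x + g x with hf
  have hfs : ContDiff ℝ ∞ f := hφ.add hgs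
  have hfb : ∀ x : Plane, b ≤ ‖x‖ ^ 2 → f x = 2 * M (Real.log (1 + b)) := fun x hx => by
    simp only [hf]
    rw [hgb x hx, hsupp x (by linarith), zero_add]
  have hO := h.plane hfs (by linarith) hfb
  -- lower bound for the exponential integral
  have hexp : 4 * (∫ x, (Real.exp (φ x) - 1)) + 4 * Real.pi * (1 + 2 * a) ≤
      ∫ x, Real.exp (f x) * roundDensity x := by
    have i1 : Integrable fun x => Real.exp (φ x) - 1 :=
      ((Real.continuous_exp.comp hφ.continuous).sub continuous_const).integrable_of_hasCompactSupport
        (hasCompactSupport_of_norm_sq (R := a) fun x hx => by simp [hsupp x hx])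
    have i2 := integrable_radial_split (k := fun _ => 4) continuous_const a ((1 + a) ^ 2)
    have i3 : Integrable fun x => Real.exp (f x) * roundDensity x :=
      integrable_mul_roundDensity (Real.continuous_exp.comp hfs.continuous) fun x hx =>
        congrArg Real.exp (hfb x hx)
    rw [← integral_cap ha.le, ← integral_const_mul, ← integral_add (i1.const_mul 4) i2]
    refine integral_mono ((i1.const_mul 4).add i2) i3 fun x => ?_
    simp only [hf, Real.exp_add]
    have hp : 0 < 1 + ‖x‖ ^ 2 := by positivity
    split_ifs with hx
    · rw [hga x hx, mul_comm 2, Real.exp_mul, Real.exp_log hp, roundDensity]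
      norm_num
      field_simp
      linarith
    · rw [hsupp x (not_le.1 hx).le]
      simp only [Real.exp_zero, sub_self, mul_zero, zero_add, one_mul]
      refine mul_le_mul_of_nonneg_right ?_ (roundDensity_pos x).le
      have h1 : Real.log (1 + a) ≤ M (Real.log (1 + ‖x‖ ^ 2)) :=
        hMge _ (Real.log_le_log (by linarith) (by linarith))
      calc (1 + a) ^ 2 = Real.exp (2 * Real.log (1 + a)) := by
            rw [mul_comm 2, Real.exp_mul, Real.exp_log (by linarith)]; norm_num
        _ ≤ Real.exp (g x) := Real.exp_le_exp.2 (by simp only [hg]; linarith)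
  -- upper bound for the linear term
  have i4 : Integrable fun x => φ x * roundDensity x :=
    integrable_mul_roundDensity hφ.continuous hsupp
  have i5 : Integrable fun x => g x * roundDensity x :=
    integrable_mul_roundDensity hgs.continuous hgb
  have hlin : ∫ x, f x * roundDensity x ≤
      (∫ x, φ x * roundDensity x) + 8 * Real.pi * (b / (1 + b)) := by
    have e : ∫ x, f x * roundDensity x =
        (∫ x, φ x * roundDensity x) + ∫ x, g x * roundDensity x := by
      rw [← integral_add i4 i5]
      congr 1
      funext x
      simp only [hf]
      ring
    rw [e, ← integral_log_roundDensity (by linarith : (0 : ℝ) ≤ b)]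
    refine add_le_add le_rfl ?_
    have hcl : Continuous fun r : ℝ => Real.log (1 + r ^ 2) :=
      Continuous.log (by fun_prop) fun r => by positivity
    have hcd : Continuous fun r : ℝ => 4 / (1 + r ^ 2) ^ 2 :=
      Continuous.div (by fun_prop) (by fun_prop) fun r => by positivity
    refine integral_mono i5 (integrable_radial_split
      (k := fun r => 2 * Real.log (1 + r ^ 2) * (4 / (1 + r ^ 2) ^ 2)) (by fun_prop) b _) fun x => ?_
    have h1 := hMle (Real.log (1 + ‖x‖ ^ 2)) (Real.log_nonneg (by nlinarith [sq_nonneg ‖x‖]))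
    simp only [hg]
    split_ifs
    · exact mul_le_mul_of_nonneg_right (by linarith [h1.trans (min_le_left _ _)])
        (roundDensity_pos x).le
    · exact mul_le_mul_of_nonneg_right (by linarith [h1.trans (min_le_right _ _)])
        (roundDensity_pos x).le
  -- upper bound for the Dirichlet energy
  have i6 := integrable_norm_gradient_sq hφ hsupp
  have i7 := integrable_norm_gradient_sq hgs hgb
  have hgrad : ∀ x, ‖gradient f x‖ ^ 2 = ‖gradient φ x‖ ^ 2 +
      2 * (fderiv ℝ φ x (EuclideanSpace.single 0 1) * (4 * x 0 / (1 + ‖x‖ ^ 2)) +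
      fderiv ℝ φ x (EuclideanSpace.single 1 1) * (4 * x 1 / (1 + ‖x‖ ^ 2))) +
      ‖gradient g x‖ ^ 2 := by
    intro x
    have e : fderiv ℝ f x = fderiv ℝ φ x + fderiv ℝ g x :=
      fderiv_add (hφ.differentiable (by simp) x) (hgs.differentiable (by simp) x)
    rw [norm_gradient_sq, norm_gradient_sq, norm_gradient_sq, e]
    simp only [add_apply, hg, fderiv_saturated_log hMd]
    -- The cross term sees only the unsaturated logarithm: the derivative of M is 1 on the disc, and
    -- φ vanishes near every point outside.
    by_cases hx : ‖x‖ ^ 2 ≤ a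
    · rw [hM1 _ (Real.log_le_log (by positivity) (by linarith))]
      ring
    · have : φ =ᶠ[𝓝 x] fun _ => 0 := by
        have ho : IsOpen {y : Plane | a < ‖y‖ ^ 2} := isOpen_lt continuous_const (by fun_prop)
        filter_upwards [ho.mem_nhds (not_le.1 hx)] with y hy
        exact hsupp y (le_of_lt hy)
      simp [this.fderiv_eq]
  have hdir : ∫ x, ‖gradient f x‖ ^ 2 ≤ (∫ x, ‖gradient φ x‖ ^ 2) -
      4 * (∫ x, φ x * roundDensity x) +
      16 * Real.pi * (Real.log (1 + b) + 1 / (1 + b) - 1) := by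
    have i8 := (integral_fderiv_mul_coord_div hφ hc 0).1
    have i9 := (integral_fderiv_mul_coord_div hφ hc 1).1
    have e := integral_gradient_mul_coord_div hφ hc
    have hle : ∫ x, ‖gradient g x‖ ^ 2 ≤
        16 * Real.pi * (Real.log (1 + b) + 1 / (1 + b) - 1) := by
      rw [← integral_dirichlet_log (by linarith : (0 : ℝ) ≤ b)]
      refine integral_mono i7 (integrable_radial_split
        (k := fun r => 16 * r ^ 2 / (1 + r ^ 2) ^ 2)
        (Continuous.div (by fun_prop) (by fun_prop) fun r => by positivity) b 0) fun x => ?_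
      have e2 : ‖gradient g x‖ ^ 2 = deriv M (Real.log (1 + ‖x‖ ^ 2)) ^ 2 *
          (16 * ‖x‖ ^ 2 / (1 + ‖x‖ ^ 2) ^ 2) := by
        rw [norm_gradient_sq]
        simp only [hg, fderiv_saturated_log hMd]
        have : 16 * ‖x‖ ^ 2 / (1 + ‖x‖ ^ 2) ^ 2 =
          16 * (x 0 ^ 2 + x 1 ^ 2) / (1 + ‖x‖ ^ 2) ^ 2 := by rw [← plane_norm_sq]
        rw [this]
        generalize 1 + ‖x‖ ^ 2 = D
        ring
      simp only [e2]
      split_ifs with hx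
      · refine mul_le_of_le_one_left (by positivity) ?_
        exact pow_le_one₀ (hM01 _).1 (hM01 _).2
      · rw [hM0 _ (Real.log_le_log (by linarith) (by linarith [not_le.1 hx]))]
        simp
    have i10 : Integrable fun x =>
        2 * (fderiv ℝ φ x (EuclideanSpace.single 0 1) * (4 * x 0 / (1 + ‖x‖ ^ 2)) +
          fderiv ℝ φ x (EuclideanSpace.single 1 1) * (4 * x 1 / (1 + ‖x‖ ^ 2))) :=
      (i8.add i9).const_mul 2
    simp only [hgrad]
    rw [integral_add (by exact i6.add i10) i7, integral_add i6 i10, integral_const_mul, e]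
    linarith
  have hpi := Real.pi_pos
  set E := 1 / (16 * Real.pi) * ∫ x, ‖gradient φ x‖ ^ 2 with hE
  set X := 1 / (4 * Real.pi) * ∫ x, Real.exp (f x) * roundDensity x with hX
  have hXl : 1 / Real.pi * (∫ x, (Real.exp (φ x) - 1)) + 1 + 2 * a ≤ X := by
    rw [hX]
    calc _ = 1 / (4 * Real.pi) * (4 * (∫ x, (Real.exp (φ x) - 1)) + 4 * Real.pi * (1 + 2 * a)) := by
          field_simp
          ring
      _ ≤ _ := by gcongr
  have hlog : Real.log X ≤ E + Real.log (1 + b) + 1 := by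
    have hb0 : 0 < 1 + b := by linarith
    calc Real.log X ≤ _ := hO
      _ ≤ 1 / (16 * Real.pi) * ((∫ x, ‖gradient φ x‖ ^ 2) - 4 * (∫ x, φ x * roundDensity x) +
            16 * Real.pi * (Real.log (1 + b) + 1 / (1 + b) - 1)) +
          1 / (4 * Real.pi) * ((∫ x, φ x * roundDensity x) + 8 * Real.pi * (b / (1 + b))) := by
        gcongr
      _ = E + Real.log (1 + b) + b / (1 + b) := by
        rw [hE]
        field_simp
        ring
      _ ≤ _ := by
        have : b / (1 + b) ≤ 1 := (div_le_one hb0).2 (by linarith)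
        linarith
  refine hXl.trans ?_
  have e : (2 + a) * Real.exp (E + 1) = Real.exp (E + Real.log (1 + b) + 1) := by
    rw [add_right_comm, Real.exp_add _ (Real.log (1 + b)), Real.exp_log (by linarith), hb]
    ring
  rw [e]
  -- The case X ≤ 0 is trivial, which spares a proof that X is positive.
  rcases le_or_gt X 0 with h0 | h0
  · exact h0.trans (Real.exp_pos _).le
  · exact (Real.log_le_iff_le_exp h0).1 hlog

/-! ### Dilation to large discs. -/

lemma gradient_comp_smul {φ : Plane → ℝ} (hφ : Differentiable ℝ φ) (c : ℝ) (x : Plane) :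
    gradient (fun x => φ (c • x)) x = c • gradient φ (c • x) := by
  refine HasGradientAt.gradient ?_
  rw [hasGradientAt_iff_hasFDerivAt]
  have h := (hφ (c • x)).hasFDerivAt.comp x ((hasFDerivAt_id x).const_smul c)
  refine h.congr_fderiv ?_
  ext v
  simp

lemma integral_comp_smul_plane (F : Plane → ℝ) (l : ℝ) :
    ∫ x, F (l⁻¹ • x) = l ^ 2 * ∫ x, F x := by
  rw [Measure.integral_comp_smul]
  simp

theorem OnofriInequality.exp_test_disc_le (h : OnofriInequality) {φ : Plane → ℝ}
    (hφ : ContDiff ℝ ∞ φ) (hs : tsupport φ ⊆ Metric.ball (0 : Plane) 1) :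
    1 / Real.pi * (∫ x, Real.exp (φ x) ∂discMeasure) + 1 ≤
      Real.exp (1 / (16 * Real.pi) * (∫ x, ‖gradient φ x‖ ^ 2 ∂discMeasure) + 1) := by
  have hφ0 : ∀ x, x ∉ Metric.ball (0 : Plane) 1 → φ x = 0 := fun x hx =>
    image_eq_zero_of_notMem_tsupport fun hx' => hx (hs hx')
  have hg0 : ∀ x, x ∉ Metric.ball (0 : Plane) 1 → gradient φ x = 0 := fun x hx => by
    have h0 : fderiv ℝ φ x = 0 :=
      image_eq_zero_of_notMem_tsupport fun hx' => hx (hs (tsupport_fderiv_subset ℝ hx'))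
    simp [gradient, h0]
  have hpi := Real.pi_pos
  have hE : ∫ x, ‖gradient φ x‖ ^ 2 ∂discMeasure = ∫ x, ‖gradient φ x‖ ^ 2 :=
    setIntegral_eq_integral_of_forall_compl_eq_zero fun x hx => by simp [hg0 x hx]
  -- Subtracting 1 gives a compactly supported integrand on the whole plane, so its integral scales
  -- under dilation.
  have hX : ∫ x, Real.exp (φ x) ∂discMeasure = (∫ x, (Real.exp (φ x) - 1)) + Real.pi := by
    have e : ∫ x, (Real.exp (φ x) - 1) ∂discMeasure = ∫ x, (Real.exp (φ x) - 1) :=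
      setIntegral_eq_integral_of_forall_compl_eq_zero fun x hx => by simp [hφ0 x hx]
    have i1 : Integrable (fun x => Real.exp (φ x)) discMeasure :=
      ((Real.continuous_exp.comp hφ.continuous).continuousOn.integrableOn_compact
        (isCompact_closedBall (0 : Plane) 1)).mono_set Metric.ball_subset_closedBall
    have i2 : IsFiniteMeasure discMeasure := by
      unfold discMeasure
      exact isFiniteMeasure_restrict.2 measure_ball_lt_top.ne
    rw [← e, integral_sub i1 (integrable_const 1)]
    simp [discMeasure, measureReal_def, EuclideanSpace.volume_ball_fin_two, Real.pi_nonneg]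
  rw [hE, hX]
  set J := ∫ x, (Real.exp (φ x) - 1) with hJ
  set K := Real.exp (1 / (16 * Real.pi) * (∫ x, ‖gradient φ x‖ ^ 2) + 1) with hK
  have key : ∀ l : ℝ, 0 < l → 1 / Real.pi * (l ^ 2 * J) + 1 + 2 * l ^ 2 ≤ (2 + l ^ 2) * K := by
    intro l hl
    have h1 := h.exp_test_le (φ := fun x => φ (l⁻¹ • x)) (hφ.comp (contDiff_id.const_smul l⁻¹))
      (a := l ^ 2) (by positivity) (fun x hx => hφ0 _ (by
        rw [mem_ball_zero_iff, norm_smul, norm_inv, Real.norm_of_nonneg hl.le, not_lt,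
          ← div_eq_inv_mul, one_le_div hl]
        exact le_of_sq_le_sq hx (norm_nonneg x)))
    have e2 : ∫ x, ‖gradient (fun x => φ (l⁻¹ • x)) x‖ ^ 2 = ∫ x, ‖gradient φ x‖ ^ 2 := by
      simp only [gradient_comp_smul (hφ.differentiable (by simp)), norm_smul, mul_pow]
      rw [integral_const_mul, integral_comp_smul_plane (fun x => ‖gradient φ x‖ ^ 2) l]
      simp
      field_simp
    rw [e2, integral_comp_smul_plane (fun x => Real.exp (φ x) - 1) l] at h1
    exact h1
  have hKpos : 0 < K := Real.exp_pos _
  have e : 1 / Real.pi * (J + Real.pi) + 1 = 1 / Real.pi * J + 2 := by field_simp; ring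
  rw [e]
  by_contra! hlt
  set δ := 1 / Real.pi * J + 2 - K with hδ
  have hδ0 : 0 < δ := by linarith
  -- `key` says l²δ + 1 ≤ 2K; at l² = 2K/δ this reads 2K + 1 ≤ 2K.
  have h2 := key (Real.sqrt (2 * K / δ)) (Real.sqrt_pos.2 (by positivity))
  rw [Real.sq_sqrt (by positivity)] at h2
  have h3 : 2 * K / δ * δ = 2 * K := by field_simp
  have h4 : 2 * K / δ * δ = 2 * K / δ * (1 / Real.pi * J) + 2 * (2 * K / δ) - 2 * K / δ * K := by
    rw [hδ]; ring
  nlinarith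

/-! ### Passage from test functions to H¹₀. -/

lemma toReal_eLpNorm_two_sq {α E : Type*} [MeasurableSpace α] [NormedAddCommGroup E]
    {μ : Measure α} {F : α → E} (hF : MemLp F 2 μ) :
    (eLpNorm F 2 μ).toReal ^ 2 = ∫ x, ‖F x‖ ^ 2 ∂μ := by
  have hnn : 0 ≤ ∫ x, ‖F x‖ ^ 2 ∂μ := integral_nonneg fun x => by positivity
  rw [hF.eLpNorm_eq_integral_rpow_norm two_ne_zero ENNReal.ofNat_ne_top]
  simp only [ENNReal.toReal_ofNat, Real.rpow_ofNat]
  rw [ENNReal.toReal_ofReal (by positivity), ← Real.rpow_natCast, ← Real.rpow_mul hnn]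
  simp

lemma tendsto_integral_norm_sq {α E : Type*} [MeasurableSpace α] [NormedAddCommGroup E]
    {μ : Measure α} {F : ℕ → α → E} {G : α → E} (hF : ∀ n, MemLp (F n) 2 μ) (hG : MemLp G 2 μ)
    (h : Tendsto (fun n => eLpNorm (fun x => F n x - G x) 2 μ) atTop (𝓝 0)) :
    Tendsto (fun n => ∫ x, ‖F n x‖ ^ 2 ∂μ) atTop (𝓝 (∫ x, ‖G x‖ ^ 2 ∂μ)) := by
  simp only [← toReal_eLpNorm_two_sq hG, ← toReal_eLpNorm_two_sq (hF _)]
  refine Tendsto.pow ?_ 2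
  have h1 : Tendsto (fun n => (hF n).toLp (F n)) atTop (𝓝 (hG.toLp G)) :=
    (Lp.tendsto_Lp_iff_tendsto_eLpNorm'' _ hF _ hG).2 h
  simpa [Lp.norm_toLp] using h1.norm

/-- Fatou's lemma along an almost everywhere convergent subsequence, with convergent energies. The
lower integral is used because integrability of e^u is itself a consequence of the bound. -/
theorem OnofriInequality.lintegral_exp_disc_le (h : OnofriInequality) {u : Plane → ℝ}
    {G : Plane → Plane} (hu : HasDiscH10Gradient u G) :
    ∫⁻ x, ENNReal.ofReal (Real.exp (u x)) ∂discMeasure ≤ ENNReal.ofReal (Real.pi *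
      (Real.exp (1 / (16 * Real.pi) * (∫ x, ‖G x‖ ^ 2 ∂discMeasure) + 1) - 1)) := by
  obtain ⟨φ, hφ, hφu, hφG⟩ := hu.approx
  have hpi := Real.pi_pos
  have hmeas : ∀ n, AEStronglyMeasurable (φ n) discMeasure := fun n =>
    (hφ n).1.continuous.aestronglyMeasurable
  obtain ⟨ns, hns, hae⟩ := (tendstoInMeasure_of_tendsto_eLpNorm two_ne_zero hmeas
    hu.memLp.aestronglyMeasurable hφu).exists_seq_tendsto_ae
  have hgmem : ∀ n, MemLp (gradient (φ n)) 2 discMeasure := fun n => by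
    have hc : HasCompactSupport (gradient (φ n)) :=
      ((hφ n).2.1.fderiv (𝕜 := ℝ)).comp_left (map_zero _)
    exact ((continuous_gradient_plane (hφ n).1).memLp_of_hasCompactSupport hc).restrict _
  have hE := (tendsto_integral_norm_sq hgmem hu.memLp_gradient hφG).comp hns.tendsto_atTop
  set b : ℝ → ℝ≥0∞ := fun E => ENNReal.ofReal
    (Real.pi * (Real.exp (1 / (16 * Real.pi) * E + 1) - 1)) with hb
  have hbc : Continuous b := ENNReal.continuous_ofReal.comp (by fun_prop)
  have hle : ∀ n, ∫⁻ x, ENNReal.ofReal (Real.exp (φ n x)) ∂discMeasure ≤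
      b (∫ x, ‖gradient (φ n) x‖ ^ 2 ∂discMeasure) := by
    intro n
    have i1 : Integrable (fun x => Real.exp (φ n x)) discMeasure :=
      ((Real.continuous_exp.comp (hφ n).1.continuous).continuousOn.integrableOn_compact
        (isCompact_closedBall (0 : Plane) 1)).mono_set Metric.ball_subset_closedBall
    rw [← ofReal_integral_eq_lintegral_ofReal i1
      (Eventually.of_forall fun x => (Real.exp_pos _).le)]
    refine ENNReal.ofReal_le_ofReal ?_
    have h1 := h.exp_test_disc_le (hφ n).1 (hφ n).2.2
    rw [← le_sub_iff_add_le, one_div, inv_mul_le_iff₀ hpi] at h1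
    exact h1
  calc ∫⁻ x, ENNReal.ofReal (Real.exp (u x)) ∂discMeasure
      = ∫⁻ x, liminf (fun k => ENNReal.ofReal (Real.exp (φ (ns k) x))) atTop ∂discMeasure := by
        refine lintegral_congr_ae ?_
        filter_upwards [hae] with x hx
        exact (((ENNReal.continuous_ofReal.comp Real.continuous_exp).tendsto _).comp
          hx).liminf_eq.symm
    _ ≤ liminf (fun k => ∫⁻ x, ENNReal.ofReal (Real.exp (φ (ns k) x)) ∂discMeasure) atTop :=
        lintegral_liminf_le fun k =>
          ((Real.continuous_exp.comp (hφ (ns k)).1.continuous).measurable).ennreal_ofReal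
    _ ≤ liminf (fun k => b (∫ x, ‖gradient (φ (ns k)) x‖ ^ 2 ∂discMeasure)) atTop :=
        liminf_le_liminf (Eventually.of_forall fun k => hle (ns k))
    _ = b (∫ x, ‖G x‖ ^ 2 ∂discMeasure) := ((hbc.tendsto _).comp hE).liminf_eq

theorem mainTheorem3 (hOnofri : OnofriInequality)
    (u : Plane → ℝ) (G : Plane → Plane) (hu : HasDiscH10Gradient u G) :
    Integrable (fun x => Real.exp (u x)) discMeasure ∧
    Real.log (1 / Real.pi * ∫ x, Real.exp (u x) ∂discMeasure) <
      1 / (16 * Real.pi) * ∫ x, ‖G x‖ ^ 2 ∂discMeasure + 1 := by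
  have hpi := Real.pi_pos
  have hle := hOnofri.lintegral_exp_disc_le hu
  have hE : 0 ≤ 1 / (16 * Real.pi) * ∫ x, ‖G x‖ ^ 2 ∂discMeasure :=
    mul_nonneg (by positivity) (integral_nonneg fun x => by positivity)
  set E := 1 / (16 * Real.pi) * ∫ x, ‖G x‖ ^ 2 ∂discMeasure
  have hm : AEStronglyMeasurable (fun x => Real.exp (u x)) discMeasure :=
    Real.continuous_exp.comp_aestronglyMeasurable hu.memLp.aestronglyMeasurable
  have hnn : 0 ≤ᵐ[discMeasure] fun x => Real.exp (u x) :=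
    Eventually.of_forall fun x => (Real.exp_pos _).le
  have hpos : 0 ≤ Real.pi * (Real.exp (E + 1) - 1) :=
    mul_nonneg hpi.le (sub_nonneg.2 (Real.one_le_exp (by linarith)))
  refine ⟨⟨hm, (hasFiniteIntegral_iff_ofReal hnn).2 (hle.trans_lt ENNReal.ofReal_lt_top)⟩, ?_⟩
  have hX : 1 / Real.pi * ∫ x, Real.exp (u x) ∂discMeasure ≤ Real.exp (E + 1) - 1 := by
    rw [integral_eq_lintegral_of_nonneg_ae hnn hm, one_div, inv_mul_le_iff₀ hpi]
    exact ENNReal.toReal_le_of_le_ofReal hpos hle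
  have hX0 : 0 ≤ 1 / Real.pi * ∫ x, Real.exp (u x) ∂discMeasure :=
    mul_nonneg (by positivity) (integral_nonneg fun x => (Real.exp_pos _).le)
  -- Positivity of the integral need not be shown: if it were 0, the convention log 0 = 0 and E ≥ 0
  -- would suffice.
  rcases hX0.eq_or_lt with h0 | h0
  · rw [← h0, Real.log_zero]
    linarith
  · rw [Real.log_lt_iff_lt_exp h0]
    linarith
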